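/- A compact set $F\subset\mathbb C$ with at least two points is called uniformly perfect if there is a finite upper bound for $\log(R/r)$ over all $w\in\mathbb C$ and $0<r<R$ such that $F\cap\{z: r<|z-w|<R\}=\emptyset$ while $F$ meets both $\{z:|z-w|\le r\}$ and $\{z:|z-w|\ge R\}$. A compact set $E\subset\mathbb C$ is called hereditarily non uniformly perfect (HNUP) if no subset of $E$ is uniformly perfect. Write $\dim_H$ for Hausdorff dimension, $H^s$ for $s$-dimensional Hausdorff measure (the limit as $\epsilon\to0^+$ of the infima of $\sum_k (\operatorname{diam} B_k)^s$ over countable covers by sets of diameter less than $\epsilon$), $m_2$ for two-dimensional Lebesgue measure, and $\operatorname{Cap}E=\lim_{n\to\infty}\Big(\max_{z_1,\dots,z_n\in E}\prod_{j<k}|z_j-z_k|\Big)^{2/(n(n-1))}$ for the logarithmic capacity of a nonempty compact set $E\subset\mathbb C$. Theorem. There exists a compact HNUP set $E\subset\mathbb C$ such that $\dim_H E=2$, $m_2(E)=0$ and $\operatorname{Cap}E>0$. Hence, for any $0<s<2$ and any $0<c<\infty$, there exists a compact HNUP subset $K$ of $E$ such that $\dim_H K=s$ and $H^s(K)=c$.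 Moreover, the set $E$ can be arranged to satisfy in addition: for each $x\in E$ and each $M>1$ there exist two positive numbers $r,R$ with $R/r\ge M$ such that $\{y\in\mathbb C: r<|y-x|<R\}\subset\mathbb C\setminus E$ and $\{y\in\mathbb C:|y-x|\ge R\}\cap E\ne\emptyset$. -/

import Mathlib

open MeasureTheory Filter Topology

/-- The true annulus `{z : r < |z - w| < R}`. -/
def trueAnnulus (w : ℂ) (r R : ℝ) : Set ℂ := {z | r < ‖z - w‖ ∧ ‖z - w‖ < R}

/-- The annulus `trueAnnulus w r R` (with `0 < r < R`) separates `F`: it is disjoint from `F`, and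
`F` meets both components `{|z - w| ≤ r}` and `{R ≤ |z - w|}` of its complement. -/
def AnnulusSeparates (w : ℂ) (r R : ℝ) (F : Set ℂ) : Prop :=
  (F ∩ {z | ‖z - w‖ ≤ r}).Nonempty ∧ (F ∩ {z | R ≤ ‖z - w‖}).Nonempty ∧
    F ∩ trueAnnulus w r R = ∅

/-- A compact set with at least two points is uniformly perfect if the moduli `log (R / r)` of all
annuli that separate it have a common upper bound. -/
def IsUniformlyPerfect (F : Set ℂ) : Prop :=
  IsCompact F ∧ F.Nontrivial ∧
    ∃ M : ℝ, ∀ (w : ℂ) (r R : ℝ), 0 < r → r < R → AnnulusSeparates w r R F → Real.log (R / r) ≤ M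

/-- Hereditarily non uniformly perfect: a compact set with no uniformly perfect subset. -/
def IsHNUP (E : Set ℂ) : Prop :=
  IsCompact E ∧ ∀ F : Set ℂ, F ⊆ E → ¬ IsUniformlyPerfect F

/-- The supremum (a maximum for nonempty compact `E`) of `∏_{j < k} |z_j - z_k|` over all
`n`-tuples of points of `E`. -/
noncomputable def maxDistProd (E : Set ℂ) (n : ℕ) : ℝ :=
  sSup ((fun z : Fin n → ℂ => ∏ j : Fin n, ∏ k ∈ Finset.Ioi j, ‖z j - z k‖) ''
    {z | ∀ j, z j ∈ E})

/-- The `n`-th diameter of `E` (meaningful for `n ≥ 2`). -/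
noncomputable def nthDiam (E : Set ℂ) (n : ℕ) : ℝ :=
  maxDistProd E n ^ ((2 : ℝ) / ((n : ℝ) * ((n : ℝ) - 1)))

/-- Logarithmic capacity of a compact set, as its transfinite diameter, the limit of the `n`-th
diameters. -/
noncomputable def logCap (E : Set ℂ) : ℝ := limUnder atTop (nthDiam E)

/-! The set is `E = C × C`, where `C` consists of the reals in `[0, 1]` having a binary expansion
that vanishes on every block `[n! - n, n!)`. The blocks grow arbitrarily long, yet have density zero
among the positions.

Long blocks make `E` thin everywhere at some scales: points of `C` at distance well below `2^(-m)`
share their digits before a block `[m, m + g)`, so they are within `2^(-(m + g))`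
(`abs_sub_le_of_gap`). Hence every point of `E` is the centre of arbitrarily small, arbitrarily
thick annuli missing `E`. This defeats uniform perfectness of every subset and, by Lebesgue density,
forces area zero.

Density zero makes `E` large. For each `t < 1` the free positions contain a set `T` with about `t *
k` elements below `k` (`exists_subset_count`). Independent fair digits on `T` give a product measure
on `E` whose ball of radius `2^(-k)` has mass at most a constant times `4^(-t * k)`. The mass
distribution principle then bounds the Hausdorff measure in dimension `2 * t` from below, and covers
at the scales `2^(-n!)` bound it from above. Cutting by a vertical line yields any prescribed value,
and `t → 1` gives dimension 2. Summability of the same masses bounds the mean logarithmic potential,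
so points chosen greedily keep the `n`-th diameters away from zero. -/

/-! ### Transfinite diameter: monotonicity and lower bounds. -/

theorem prod_Ioi_eq_prod_ite {n : ℕ} (f : Fin n → Fin n → ℝ) :
    ∏ j, ∏ k ∈ Finset.Ioi j, f j k = ∏ j, ∏ k, if j < k then f j k else 1 := by
  refine Finset.prod_congr rfl fun j _ => ?_
  rw [← Finset.prod_filter]
  congr 1
  ext k
  simp

/-- Multiplying, over all `i`, the products over the pairs that avoid `i`. -/
theorem prod_prod_succAbove_pairs {m : ℕ} (f : Fin (m + 2) → Fin (m + 2) → ℝ) :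
    ∏ i : Fin (m + 2), ∏ j : Fin (m + 1), ∏ k ∈ Finset.Ioi j, f (i.succAbove j) (i.succAbove k) =
      (∏ j, ∏ k ∈ Finset.Ioi j, f j k) ^ m := by
  have h1 : ∀ i : Fin (m + 2),
      ∏ j : Fin (m + 1), ∏ k ∈ Finset.Ioi j, f (i.succAbove j) (i.succAbove k) =
      ∏ j, ∏ k, if j < k ∧ j ≠ i ∧ k ≠ i then f j k else 1 := by
    intro i
    rw [Fin.prod_univ_succAbove _ i]
    simp only [ne_eq, not_true_eq_false, false_and, and_false, if_false, Finset.prod_const_one,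
      one_mul]
    rw [prod_Ioi_eq_prod_ite (fun j k => f (i.succAbove j) (i.succAbove k))]
    refine Finset.prod_congr rfl fun j _ => ?_
    rw [Fin.prod_univ_succAbove _ i]
    simp [Fin.succAbove_ne]
  simp_rw [h1]
  rw [prod_Ioi_eq_prod_ite, ← Finset.prod_pow, Finset.prod_comm]
  refine Finset.prod_congr rfl fun j _ => ?_
  rw [← Finset.prod_pow, Finset.prod_comm]
  refine Finset.prod_congr rfl fun k _ => ?_
  by_cases hjk : j < k
  · have : ∀ i, (if j < k ∧ j ≠ i ∧ k ≠ i then f j k else 1) =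
        if i ∈ ({j, k} : Finset (Fin (m + 2)))ᶜ then f j k else 1 := by
      intro i
      simp only [hjk, true_and, Finset.mem_compl, Finset.mem_insert, Finset.mem_singleton, not_or,
        ne_eq, eq_comm]
    simp_rw [this]
    rw [Finset.prod_ite_mem, Finset.univ_inter, Finset.prod_const, Finset.card_compl,
      Finset.card_pair hjk.ne]
    simp [hjk]
  · simp [hjk]

theorem bddAbove_distProd {E : Set ℂ} (hE : IsCompact E) (n : ℕ) :
    BddAbove ((fun z : Fin n → ℂ => ∏ j : Fin n, ∏ k ∈ Finset.Ioi j, ‖z j - z k‖) ''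
      {z | ∀ j, z j ∈ E}) := by
  have h : IsCompact {z : Fin n → ℂ | ∀ j, z j ∈ E} := by
    convert! isCompact_univ_pi (fun _ : Fin n => hE) using 1
    ext z
    simp
  exact (h.image (by fun_prop)).bddAbove

theorem le_maxDistProd {E : Set ℂ} (hE : IsCompact E) {n : ℕ} {z : Fin n → ℂ}
    (hz : ∀ j, z j ∈ E) : ∏ j : Fin n, ∏ k ∈ Finset.Ioi j, ‖z j - z k‖ ≤ maxDistProd E n :=
  le_csSup (bddAbove_distProd hE n) ⟨z, hz, rfl⟩

theorem maxDistProd_nonneg (E : Set ℂ) (n : ℕ) : 0 ≤ maxDistProd E n := by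
  refine Real.sSup_nonneg ?_
  rintro _ ⟨z, -, rfl⟩
  positivity

/-- Delete each of the `m + 2` points in turn: a given pair survives exactly `m` of the deletions,
and each remaining product is at most the maximum for `m + 1` points. -/
theorem maxDistProd_pow_le {E : Set ℂ} (hE : IsCompact E) (hne : E.Nonempty) (m : ℕ) :
    maxDistProd E (m + 2) ^ m ≤ maxDistProd E (m + 1) ^ (m + 2) := by
  have h : ∀ z : Fin (m + 2) → ℂ, (∀ j, z j ∈ E) →
      (∏ j, ∏ k ∈ Finset.Ioi j, ‖z j - z k‖) ^ m ≤ maxDistProd E (m + 1) ^ (m + 2) := by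
    intro z hz
    rw [← prod_prod_succAbove_pairs (fun j k => ‖z j - z k‖)]
    refine (Finset.prod_le_prod (fun i _ => by positivity)
      (fun i _ => le_maxDistProd (z := fun j => z (i.succAbove j)) hE (fun j => hz _))).trans ?_
    simp
  have hc : IsCompact {z : Fin (m + 2) → ℂ | ∀ j, z j ∈ E} := by
    convert! isCompact_univ_pi (fun _ : Fin (m + 2) => hE) using 1
    ext z
    simp
  obtain ⟨x, hx⟩ := hne
  obtain ⟨z, hz, hzm⟩ := hc.exists_sSup_image_eq ⟨fun _ => x, fun _ => hx⟩
    (f := fun z : Fin (m + 2) → ℂ => ∏ j, ∏ k ∈ Finset.Ioi j, ‖z j - z k‖) (by fun_prop)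
  have := h z hz
  rw [← hzm] at this
  exact this

theorem nthDiam_antitone {E : Set ℂ} (hE : IsCompact E) (hne : E.Nonempty) :
    Antitone fun n => nthDiam E (n + 2) := by
  refine antitone_nat_of_succ_le fun n => ?_
  have h := maxDistProd_pow_le hE hne (n + 1)
  have h0 := maxDistProd_nonneg E (n + 1 + 2)
  have h1 := maxDistProd_nonneg E (n + 1 + 1)
  have h2 := Real.rpow_le_rpow (by positivity) h
    (z := 2 / (((n : ℝ) + 1) * ((n : ℝ) + 2) * ((n : ℝ) + 3))) (by positivity)
  rw [← Real.rpow_natCast, ← Real.rpow_natCast, ← Real.rpow_mul h0, ← Real.rpow_mul h1] at h2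
  unfold nthDiam
  have e1 : (n : ℝ) + 1 + 2 - 1 = n + 2 := by ring
  have e2 : (n : ℝ) + 2 - 1 = n + 1 := by ring
  convert! h2 using 2
  · push_cast
    rw [e1]
    field_simp
    ring
  · push_cast
    rw [e2]
    field_simp
    ring

/-- A decreasing sequence bounded below converges. The shift by 2 skips the indices at which the
exponent in `nthDiam` degenerates. -/
theorem tendsto_nthDiam_of_le {E : Set ℂ} (hE : IsCompact E) (hne : E.Nonempty) {c : ℝ}
    (hc : 0 < c) (h : ∀ n, c ≤ nthDiam E (n + 2)) :
    Tendsto (nthDiam E) atTop (𝓝 (logCap E)) ∧ 0 < logCap E := by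
  have h1 : Tendsto (fun n => nthDiam E (n + 2)) atTop (𝓝 (⨅ n, nthDiam E (n + 2))) :=
    tendsto_atTop_ciInf (nthDiam_antitone hE hne) ⟨c, by rintro _ ⟨n, rfl⟩; exact h n⟩
  have h2 := (tendsto_add_atTop_iff_nat 2).1 h1
  have h3 : logCap E = ⨅ n, nthDiam E (n + 2) := h2.limUnder_eq
  rw [h3]
  exact ⟨h2, hc.trans_le (le_ciInf h)⟩

/-- If every finite set of points of `E` leaves room for a further point at geometric mean distance
at least `c` from it, then `c` is a lower bound for the `n`-th diameters. -/
theorem le_nthDiam_of_greedy {E : Set ℂ} (hE : IsCompact E) {c : ℝ} (hc : 0 < c)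
    (h : ∀ (n : ℕ) (z : Fin n → ℂ), ∃ p ∈ E, c ^ n ≤ ∏ j, ‖p - z j‖) (n : ℕ) :
    c ≤ nthDiam E (n + 2) := by
  -- Adding one greedy point to `n` points multiplies the product by at least `c ^ n`, and `0 + 1 +
  -- ... + (n - 1) = n.choose 2`.
  have key : ∀ n : ℕ, ∃ z : Fin n → ℂ, (∀ j, z j ∈ E) ∧
      c ^ (n.choose 2) ≤ ∏ j, ∏ k ∈ Finset.Ioi j, ‖z j - z k‖ := by
    intro n
    induction n with
    | zero => exact ⟨Fin.elim0, fun j => j.elim0, by simp⟩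
    | succ n ih =>
      obtain ⟨z, hz, hzc⟩ := ih
      obtain ⟨p, hp, hpc⟩ := h n z
      refine ⟨Fin.cons p z, fun j => ?_, ?_⟩
      · refine Fin.cases ?_ (fun i => ?_) j
        · simpa using hp
        · simpa using hz i
      · rw [Fin.prod_univ_succ, Nat.choose_succ_succ' n 1, Nat.choose_one_right, pow_add]
        have e1 : ∏ k ∈ Finset.Ioi (0 : Fin (n + 1)),
            ‖(Fin.cons p z : Fin (n + 1) → ℂ) 0 - (Fin.cons p z : Fin (n + 1) → ℂ) k‖ =
            ∏ j, ‖p - z j‖ := by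
          rw [Fin.Ioi_zero_eq_map]
          simp
        have e2 : ∀ i : Fin n, ∏ k ∈ Finset.Ioi i.succ,
            ‖(Fin.cons p z : Fin (n + 1) → ℂ) i.succ - (Fin.cons p z : Fin (n + 1) → ℂ) k‖ =
            ∏ k ∈ Finset.Ioi i, ‖z i - z k‖ := by
          intro i
          rw [Fin.Ioi_succ]
          simp
        rw [e1, Finset.prod_congr rfl fun i _ => e2 i]
        gcongr
  obtain ⟨z, hz, hzc⟩ := key (n + 2)
  have h1 := hzc.trans (le_maxDistProd hE hz)
  have h2 := Real.rpow_le_rpow (by positivity) h1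
    (z := (2 : ℝ) / (((n + 2 : ℕ) : ℝ) * (((n + 2 : ℕ) : ℝ) - 1))) (by push_cast; apply div_nonneg (by norm_num); apply mul_nonneg <;> linarith [n.cast_nonneg (α := ℝ)])
  refine le_trans (le_of_eq ?_) h2
  rw [← Real.rpow_natCast, ← Real.rpow_mul hc.le, Nat.cast_choose_two]
  push_cast
  have : ((n : ℝ) + 2) * (n + 2 - 1) / 2 * (2 / (((n : ℝ) + 2) * (n + 2 - 1))) = 1 := by
    have : (n : ℝ) + 2 - 1 ≠ 0 := by linarith [n.cast_nonneg (α := ℝ)]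
    field_simp
  rw [this, Real.rpow_one]

/-! ### Thick small annuli and their consequences. -/

/-- Every point of `E` is the centre of arbitrarily small annuli of arbitrarily large modulus that
miss `E`. -/
def HasThickSmallAnnuli (E : Set ℂ) : Prop :=
  ∀ x ∈ E, ∀ M : ℝ, 1 < M → ∀ ε : ℝ, 0 < ε →
    ∃ r R : ℝ, 0 < r ∧ r < R ∧ R < ε ∧ M ≤ R / r ∧ E ∩ trueAnnulus x r R = ∅

theorem IsHNUP.subset {E K : Set ℂ} (hE : IsHNUP E) (hK : IsCompact K) (h : K ⊆ E) : IsHNUP K :=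
  ⟨hK, fun F hF => hE.2 F (hF.trans h)⟩

theorem HasThickSmallAnnuli.isHNUP {E : Set ℂ} (hE : HasThickSmallAnnuli E) (hc : IsCompact E) :
    IsHNUP E := by
  refine ⟨hc, fun F hF ⟨_, ⟨x, hx, y, hy, hxy⟩, M, hM⟩ => ?_⟩
  have hpos : 0 < ‖y - x‖ := norm_pos_iff.2 (sub_ne_zero.2 hxy.symm)
  -- Keeping `R` below `‖y - x‖` makes the annulus separate `x` from `y` in `F`, with modulus at
  -- least `|M| + 1 > M`.
  obtain ⟨r, R, hr, hrR, hR, hMR, hd⟩ := hE x (hF hx) (Real.exp (|M| + 1))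
    (Real.one_lt_exp_iff.2 (by positivity)) ‖y - x‖ hpos
  have h1 := hM x r R hr hrR ⟨⟨x, hx, by simpa using hr.le⟩, ⟨y, hy, hR.le⟩,
    Set.subset_empty_iff.1 (hd ▸ Set.inter_subset_inter_left _ hF)⟩
  have h2 := Real.log_le_log (Real.exp_pos _) hMR
  rw [Real.log_exp] at h2
  linarith [le_abs_self M]

theorem HasThickSmallAnnuli.exists_annulus {E : Set ℂ} (hE : HasThickSmallAnnuli E)
    (hn : E.Nontrivial) : ∀ x ∈ E, ∀ M : ℝ, 1 < M →
      ∃ r R : ℝ, 0 < r ∧ 0 < R ∧ M ≤ R / r ∧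
        {y : ℂ | r < ‖y - x‖ ∧ ‖y - x‖ < R} ⊆ Eᶜ ∧
        ({y : ℂ | R ≤ ‖y - x‖} ∩ E).Nonempty := by
  intro x hx M hM
  obtain ⟨y, hy, hxy⟩ := hn.exists_ne x
  obtain ⟨r, R, hr, hrR, hR, hMR, hd⟩ := hE x hx M hM ‖y - x‖ (norm_pos_iff.2 (sub_ne_zero.2 hxy))
  refine ⟨r, R, hr, hr.trans hrR, hMR, fun z hz hzE => ?_, ⟨y, hR.le, hy⟩⟩
  exact Set.eq_empty_iff_forall_notMem.1 hd z ⟨hzE, hz⟩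

theorem HasThickSmallAnnuli.volume_eq_zero {E : Set ℂ} (hE : HasThickSmallAnnuli E)
    (hc : IsCompact E) : volume E = 0 := by
  have h := Besicovitch.ae_tendsto_measure_inter_div (volume : Measure ℂ) E
  have hfalse : ∀ᵐ x ∂(volume.restrict E), x ∈ (∅ : Set ℂ) := by
    filter_upwards [h, ae_restrict_mem hc.measurableSet] with x hx hxE
    exfalso
    have h1 := hx.eventually (lt_mem_nhds (b := (1 : ENNReal)) (a := 1 / 2) (by simp))
    obtain ⟨ε, hε, hball⟩ := mem_nhdsGT_iff_exists_Ioo_subset.1 h1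
    -- With `R ≥ 4 * r`, the part of `E` in the ball of radius `2 * r` lies in the ball of radius
    -- `r`, so the density quotient is at most `1 / 4` at arbitrarily small radii.
    obtain ⟨r, R, hr, hrR, hR, hMR, hd⟩ := hE x hxE 4 (by norm_num) ε hε
    rw [le_div_iff₀ hr] at hMR
    have h2 := hball (show 2 * r ∈ Set.Ioo 0 ε from ⟨by linarith, by linarith⟩)
    have hsub : E ∩ Metric.closedBall x (2 * r) ⊆ Metric.closedBall x r := by
      rintro y ⟨hy, hy2⟩
      rw [mem_closedBall_iff_norm] at hy2 ⊢
      by_contra hlt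
      exact Set.eq_empty_iff_forall_notMem.1 hd y ⟨hy, not_le.1 hlt, by linarith⟩
    have h3 : volume (E ∩ Metric.closedBall x (2 * r)) / volume (Metric.closedBall x (2 * r)) ≤
        1 / 2 := by
      refine (ENNReal.div_le_div_right (measure_mono hsub) _).trans ?_
      rw [Complex.volume_closedBall, Complex.volume_closedBall]
      refine ENNReal.div_le_of_le_mul ?_
      rw [← mul_assoc]
      gcongr
      rw [← ENNReal.ofReal_pow hr.le, ← ENNReal.ofReal_pow (by positivity),
        show (1 / 2 : ENNReal) = ENNReal.ofReal (1 / 2) by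
          rw [ENNReal.ofReal_div_of_pos] <;> simp,
        ← ENNReal.ofReal_mul (by norm_num)]
      exact ENNReal.ofReal_le_ofReal (by nlinarith)
    exact absurd h2 (not_lt.2 h3)
  have h0 := ae_iff.1 hfalse
  simpa using h0

/-! ### Reals with restricted binary digits. -/

/-- The integer whose binary digits are the first `n` terms of `ω`. -/
def binaryPrefix (ω : ℕ → Fin 2) : ℕ → ℕ
  | 0 => 0
  | n + 1 => 2 * binaryPrefix ω n + (ω n : ℕ)

theorem eq_of_binaryPrefix_eq {ω η : ℕ → Fin 2} {n : ℕ}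
    (h : binaryPrefix ω n = binaryPrefix η n) : ∀ i < n, ω i = η i := by
  induction n with
  | zero => simp
  | succ n ih =>
    simp only [binaryPrefix] at h
    have h1 := (ω n).isLt
    have h2 := (η n).isLt
    intro i hi
    rcases Nat.lt_succ_iff_lt_or_eq.1 hi with hi | rfl
    · exact ih (by omega) i hi
    · exact Fin.ext (by omega)

theorem binaryPrefix_add_of_eq_zero {ω : ℕ → Fin 2} {m g : ℕ}
    (h : ∀ i, m ≤ i → i < m + g → ω i = 0) :
    binaryPrefix ω (m + g) = 2 ^ g * binaryPrefix ω m := by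
  induction g with
  | zero => simp
  | succ g ih =>
    rw [← add_assoc]
    simp only [binaryPrefix]
    rw [ih fun i h1 h2 => h i h1 (by omega), h (m + g) (by omega) (by omega)]
    simp [pow_succ]
    ring

theorem sum_ofDigitsTerm_eq_binaryPrefix (ω : ℕ → Fin 2) (n : ℕ) :
    ∑ i ∈ Finset.range n, Real.ofDigitsTerm ω i = (binaryPrefix ω n : ℝ) / 2 ^ n := by
  induction n with
  | zero => simp [binaryPrefix]
  | succ n ih =>
    rw [Finset.sum_range_succ, ih]
    simp only [Real.ofDigitsTerm, binaryPrefix]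
    push_cast
    field_simp
    ring

theorem binaryPrefix_le_ofDigits (ω : ℕ → Fin 2) (n : ℕ) :
    (binaryPrefix ω n : ℝ) / 2 ^ n ≤ Real.ofDigits ω := by
  rw [Real.ofDigits_eq_sum_add_ofDigits ω n, sum_ofDigitsTerm_eq_binaryPrefix]
  have := Real.ofDigits_nonneg (fun i ↦ ω (i + n))
  exact le_add_of_nonneg_right (by positivity)

theorem ofDigits_le_binaryPrefix (ω : ℕ → Fin 2) (n : ℕ) :
    Real.ofDigits ω ≤ ((binaryPrefix ω n : ℝ) + 1) / 2 ^ n := by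
  rw [Real.ofDigits_eq_sum_add_ofDigits ω n, sum_ofDigitsTerm_eq_binaryPrefix, add_div]
  have := Real.ofDigits_le_one (fun i ↦ ω (i + n))
  gcongr
  rw [one_div]
  exact_mod_cast mul_le_of_le_one_right (by positivity) this

/-- The reals in `[0, 1]` with a binary expansion supported in `S`. -/
def digitCantor (S : Set ℕ) : Set ℝ := Real.ofDigits '' {ω : ℕ → Fin 2 | ∀ i ∉ S, ω i = 0}

theorem isClosed_digits (S : Set ℕ) : IsClosed {ω : ℕ → Fin 2 | ∀ i ∉ S, ω i = 0} := by
  simp only [Set.ofPred_forall]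
  exact isClosed_iInter fun i => isClosed_iInter fun _ =>
    isClosed_eq (continuous_apply i) continuous_const

theorem isCompact_digitCantor (S : Set ℕ) : IsCompact (digitCantor S) :=
  (isClosed_digits S).isCompact.image Real.continuous_ofDigits

theorem digitCantor_mono {S T : Set ℕ} (h : S ⊆ T) : digitCantor S ⊆ digitCantor T :=
  Set.image_mono fun _ hω i hi => hω i fun hS => hi (h hS)

theorem digitCantor_subset_Icc (S : Set ℕ) : digitCantor S ⊆ Set.Icc 0 1 := by
  rintro _ ⟨ω, -, rfl⟩
  exact ⟨Real.ofDigits_nonneg ω, Real.ofDigits_le_one ω⟩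

/-- In units of `2^(-(m + g))`, a point whose first `m` digits form the integer `u` lies in `[2^g *
u, 2^g * u + 1]`. Distinct values of `u` are therefore at least `2^g - 1` units apart, and equal
ones at most one unit. -/
theorem abs_sub_le_of_gap {S : Set ℕ} {m g : ℕ} (hS : ∀ i, m ≤ i → i < m + g → i ∉ S)
    {x y : ℝ} (hx : x ∈ digitCantor S) (hy : y ∈ digitCantor S)
    (hxy : |x - y| < (2 ^ g - 1) / 2 ^ (m + g)) : |x - y| ≤ 1 / 2 ^ (m + g) := by
  obtain ⟨ω, hω, rfl⟩ := hx
  obtain ⟨η, hη, rfl⟩ := hy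
  have p1 := binaryPrefix_add_of_eq_zero (fun i h1 h2 => hω i (hS i h1 h2))
  have p2 := binaryPrefix_add_of_eq_zero (fun i h1 h2 => hη i (hS i h1 h2))
  have a1 := binaryPrefix_le_ofDigits ω (m + g)
  have a2 := ofDigits_le_binaryPrefix ω (m + g)
  have b1 := binaryPrefix_le_ofDigits η (m + g)
  have b2 := ofDigits_le_binaryPrefix η (m + g)
  rw [p1] at a1 a2
  rw [p2] at b1 b2
  push_cast at a1 a2 b1 b2
  have hN : (0 : ℝ) < 2 ^ (m + g) := by positivity
  have hg : (0 : ℝ) < 2 ^ g := by positivity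
  set N : ℝ := 2 ^ (m + g)
  rw [div_le_iff₀ hN] at a1 b1
  rw [le_div_iff₀ hN] at a2 b2
  have key : ∀ u v : ℕ, u < v → (2 : ℝ) ^ g * u + 2 ^ g ≤ 2 ^ g * v := by
    intro u v huv
    have : (u : ℝ) + 1 ≤ v := by exact_mod_cast huv
    nlinarith
  have e : |Real.ofDigits ω - Real.ofDigits η| * N =
      |Real.ofDigits ω * N - Real.ofDigits η * N| := by
    rw [← sub_mul, abs_mul, abs_of_pos hN]
  rw [lt_div_iff₀ hN, e, abs_lt] at hxy
  rw [le_div_iff₀ hN, e, abs_le]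
  rcases lt_trichotomy (binaryPrefix ω m) (binaryPrefix η m) with h | h | h
  · have := key _ _ h
    linarith
  · rw [h] at a1 a2
    constructor <;> linarith
  · have := key _ _ h
    linarith

open Complex in
theorem hasThickSmallAnnuli_reProdIm {S : Set ℕ}
    (hS : ∀ N : ℕ, ∃ m g : ℕ, N ≤ m ∧ N ≤ g ∧ ∀ i, m ≤ i → i < m + g → i ∉ S) :
    HasThickSmallAnnuli (digitCantor S ×ℂ digitCantor S) := by
  intro x hx M hM ε hε
  obtain ⟨N₁, hN₁⟩ := exists_nat_gt (2 * M + 1)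
  obtain ⟨N₂, hN₂⟩ := exists_pow_lt_of_lt_one hε (by norm_num : (1 / 2 : ℝ) < 1)
  obtain ⟨m, g, hm, hg, hgap⟩ := hS (max N₁ N₂)
  have hp : (0 : ℝ) < 2 ^ (m + g) := by positivity
  have hgM : 2 * M + 1 < 2 ^ g := by
    have h1 : (g : ℝ) < 2 ^ g := by exact_mod_cast Nat.lt_two_pow_self
    have h2 : (N₁ : ℝ) ≤ g := by exact_mod_cast (le_max_left _ _).trans hg
    linarith
  -- The inner radius adds one unit for each coordinate; the outer one is the separation of distinct
  -- prefixes. The ratio `(2^g - 1) / 2` exceeds `M`, and `R < 2^(-m) < ε`.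
  refine ⟨2 / 2 ^ (m + g), (2 ^ g - 1) / 2 ^ (m + g), by positivity, ?_, ?_, ?_, ?_⟩
  · gcongr
    linarith
  · refine lt_of_le_of_lt ?_ hN₂
    have h3 : ((1 : ℝ) / 2) ^ m ≤ (1 / 2) ^ N₂ :=
      pow_le_pow_of_le_one (by norm_num) (by norm_num) ((le_max_right _ _).trans hm)
    refine le_trans ?_ h3
    rw [div_le_iff₀ hp, pow_add, ← mul_assoc, ← mul_pow]
    norm_num
  · rw [div_div_div_cancel_right₀ hp.ne', le_div_iff₀ (by norm_num)]
    linarith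
  · rw [Set.eq_empty_iff_forall_notMem]
    rintro y ⟨hy, h1, h2⟩
    rw [mem_reProdIm] at hx hy
    have hre := abs_sub_le_of_gap hgap hy.1 hx.1
      (((Complex.abs_re_le_norm (y - x)).trans_lt h2))
    have him := abs_sub_le_of_gap hgap hy.2 hx.2
      (((Complex.abs_im_le_norm (y - x)).trans_lt h2))
    have := Complex.norm_le_abs_re_add_abs_im (y - x)
    rw [Complex.sub_re, Complex.sub_im] at this
    have e : (2 : ℝ) / 2 ^ (m + g) = 1 / 2 ^ (m + g) + 1 / 2 ^ (m + g) := by ring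
    linarith

/-! ### Gaps before factorials and free subsets of prescribed density. -/

/-- The positions outside the gaps `[n! - n, n!)`. -/
def factorialGapCompl : Set ℕ :=
  {i | ∀ n : ℕ, n.factorial - n ≤ i → n.factorial ≤ i}

theorem exists_long_gap (N : ℕ) :
    ∃ m g : ℕ, N ≤ m ∧ N ≤ g ∧ ∀ i, m ≤ i → i < m + g → i ∉ factorialGapCompl := by
  -- The shift by 3 ensures `2 * n ≤ n!`, so the natural subtraction `n! - n` is not truncated and
  -- the gap starts beyond `N`.
  have h : 2 * (N + 3) ≤ (N + 3).factorial := by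
    have := Nat.self_le_factorial (N + 2)
    rw [Nat.factorial_succ, mul_comm]
    exact Nat.mul_le_mul_left _ (by omega)
  refine ⟨(N + 3).factorial - (N + 3), N + 3, by omega, by omega, fun i h1 h2 hi => ?_⟩
  have := hi (N + 3) h1
  omega

theorem mem_factorialGapCompl {n i : ℕ} (h1 : n.factorial ≤ i)
    (h2 : i < (n + 1).factorial - (n + 1)) : i ∈ factorialGapCompl := by
  intro m hm
  rcases Nat.lt_or_ge n m with h | h
  · exfalso
    have key : (n + 1).factorial - (n + 1) ≤ m.factorial - m := by
      refine Nat.le_induction le_rfl (fun k hk ih => ih.trans ?_) m h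
      have h3 := Nat.factorial_pos k
      rw [Nat.factorial_succ]
      have : k.factorial + 1 ≤ (k + 1) * k.factorial := by nlinarith
      omega
    omega
  · exact (Nat.factorial_le h).trans h1

open Classical in
/-- Running count of a set that takes the elements of `S` greedily, as long as the count at `n!`
stays bounded by `B n`. -/
noncomputable def greedyCount (S : Set ℕ) (B : ℕ → ℕ) : ℕ → ℕ
  | 0 => 0
  | i + 1 => greedyCount S B i +
      if i ∈ S ∧ ∀ n : ℕ, i < n.factorial → greedyCount S B i < B n then 1 else 0

/-- The set of elements of `S` taken by the greedy procedure. -/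
def greedySubset (S : Set ℕ) (B : ℕ → ℕ) : Set ℕ :=
  {i | i ∈ S ∧ ∀ n : ℕ, i < n.factorial → greedyCount S B i < B n}

open Classical in
theorem count_greedySubset (S : Set ℕ) (B : ℕ → ℕ) (k : ℕ) :
    Nat.count (· ∈ greedySubset S B) k = greedyCount S B k := by
  induction k with
  | zero => simp [greedyCount]
  | succ k ih =>
    rw [Nat.count_succ, ih, greedyCount]
    congr

theorem greedyCount_le (S : Set ℕ) (B : ℕ → ℕ) (n k : ℕ) (hk : k ≤ n.factorial) :
    greedyCount S B k ≤ B n := by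
  induction k with
  | zero => simp [greedyCount]
  | succ k ih =>
    have := ih (by omega)
    rw [greedyCount]
    split_ifs with h
    · exact h.2 n (by omega)
    · omega

theorem greedyCount_mono (S : Set ℕ) (B : ℕ → ℕ) : Monotone (greedyCount S B) :=
  monotone_nat_of_le_succ fun n => by
    rw [greedyCount]
    omega

-- Past `n!` only the caps `B m` with `m > n` are active, and by monotonicity the strictest is `B (n
-- + 1)`. Until that cap is reached, every available position is taken.
open Classical in
theorem le_greedyCount {S : Set ℕ} {B : ℕ → ℕ} (hB : Monotone B) {n L : ℕ}
    (hS : ∀ i, n.factorial ≤ i → i < n.factorial + L → i ∈ S) (j : ℕ) (hj : j ≤ L) :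
    min (B (n + 1)) (greedyCount S B n.factorial + j) ≤ greedyCount S B (n.factorial + j) := by
  induction j with
  | zero => simp
  | succ j ih =>
    have := ih (by omega)
    have hstep : greedyCount S B (n.factorial + (j + 1)) = greedyCount S B (n.factorial + j) +
        if n.factorial + j ∈ S ∧ ∀ m : ℕ, n.factorial + j < m.factorial →
          greedyCount S B (n.factorial + j) < B m then 1 else 0 := rfl
    rw [hstep]
    split_ifs with h
    · omega
    · rw [not_and] at h
      have h1 := h (hS _ (by omega) (by omega))
      push Not at h1
      obtain ⟨m, hm, hle⟩ := h1
      have hnm : n < m := by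
        by_contra hcon
        have := Nat.factorial_le (not_lt.1 hcon)
        omega
      have := hB (Nat.succ_le_of_lt hnm)
      simp only [Nat.succ_eq_add_one] at this
      omega

open Classical in
/-- Inside `factorialGapCompl` there are sets of any prescribed density `t`, with counting function
at least `t * k + a` from some point on and at most `t * k + a + 1` at the factorials. -/
theorem exists_subset_count {t : ℝ} (ht0 : 0 < t) (ht1 : t < 1) (a : ℕ) :
    ∃ T ⊆ factorialGapCompl, (∃ k₀ : ℕ, ∀ k ≥ k₀, t * k + a ≤ Nat.count (· ∈ T) k) ∧
      ∀ n : ℕ, (Nat.count (· ∈ T) n.factorial : ℝ) ≤ t * n.factorial + a + 1 := by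
  set B : ℕ → ℕ := fun n => ⌈t * n.factorial⌉₊ + a with hBdef
  have hB : Monotone B := fun m n h => by
    have : (m.factorial : ℝ) ≤ n.factorial := by exact_mod_cast Nat.factorial_le h
    simp only [hBdef]
    gcongr
  have hBlow : ∀ n, t * n.factorial + a ≤ B n := fun n => by
    simp only [hBdef]
    push_cast
    linarith [Nat.le_ceil (t * (n.factorial : ℝ))]
  have hBup : ∀ n, (B n : ℝ) ≤ t * n.factorial + a + 1 := fun n => by
    simp only [hBdef]
    push_cast
    linarith [Nat.ceil_lt_add_one (show 0 ≤ t * (n.factorial : ℝ) by positivity)]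
  refine ⟨greedySubset factorialGapCompl B, fun i hi => hi.1, ?_, fun n => ?_⟩
  swap
  · rw [count_greedySubset]
    exact le_trans (by exact_mod_cast greedyCount_le _ _ n _ le_rfl) (hBup n)
  -- For `n ≥ n₀` the free stretch after `n!` is longer than `B (n + 1)`: then `(1 - t) * (n + 1)! ≥
  -- (a + 4) * n!`, which absorbs `n!`, the excess `a + 1` of the cap, and the gap of length `n +
  -- 1`.
  obtain ⟨n₀, hn₀⟩ := exists_nat_gt ((a + 4) / (1 - t))
  have hroom : ∀ n ≥ n₀, n.factorial + B (n + 1) + (n + 1) ≤ (n + 1).factorial := by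
    intro n hn
    have h1 : (a + 4 : ℝ) ≤ (n + 1) * (1 - t) := by
      rw [div_lt_iff₀ (by linarith)] at hn₀
      have : (n₀ : ℝ) ≤ n := by exact_mod_cast hn
      nlinarith
    have h2 : (n : ℝ) ≤ n.factorial := by exact_mod_cast Nat.self_le_factorial n
    have h3 : (1 : ℝ) ≤ n.factorial := by exact_mod_cast Nat.factorial_pos n
    have h4 := hBup (n + 1)
    have h5 : ((n + 1).factorial : ℝ) = (n + 1) * n.factorial := by
      rw [Nat.factorial_succ]
      push_cast
      ring
    rw [h5] at h4
    have h6 : (n.factorial + B (n + 1) + (n + 1) : ℝ) ≤ (n + 1).factorial := by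
      rw [h5]
      have h7 := mul_le_mul_of_nonneg_right h1 (by positivity : (0 : ℝ) ≤ n.factorial)
      have h8 : (a : ℝ) ≤ a * n.factorial := le_mul_of_one_le_right (by positivity) h3
      nlinarith
    exact_mod_cast h6
  have hfree : ∀ n ≥ n₀, ∀ j ≤ B (n + 1),
      min (B (n + 1)) (greedyCount factorialGapCompl B n.factorial + j) ≤
        greedyCount factorialGapCompl B (n.factorial + j) := by
    intro n hn
    have := hroom n hn
    exact le_greedyCount hB fun i h1 h2 => mem_factorialGapCompl h1 (by omega)
  have hfull : ∀ n ≥ n₀, B (n + 1) ≤ greedyCount factorialGapCompl B (n.factorial + B (n + 1)) := by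
    intro n hn
    have := hfree n hn _ le_rfl
    omega
  refine ⟨(n₀ + 1).factorial, fun k hk => ?_⟩
  rw [count_greedySubset]
  obtain ⟨n, hn, hnk, hkn⟩ : ∃ n, n₀ + 1 ≤ n ∧ n.factorial ≤ k ∧ k < (n + 1).factorial := by
    have hex : ∃ m : ℕ, k < m.factorial := ⟨k + 1, (Nat.self_le_factorial _)⟩
    have h1 := Nat.find_spec hex
    have h2 : n₀ + 1 < Nat.find hex := by
      by_contra hcon
      have := Nat.factorial_le (not_lt.1 hcon)
      omega
    obtain ⟨m, hm⟩ : ∃ m, Nat.find hex = m + 1 := ⟨Nat.find hex - 1, by omega⟩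
    refine ⟨m, by omega, ?_, hm ▸ h1⟩
    have := Nat.find_min hex (m := m) (by omega)
    omega
  have hprev : B n ≤ greedyCount factorialGapCompl B n.factorial := by
    obtain ⟨m, rfl⟩ : ∃ m, n = m + 1 := ⟨n - 1, by omega⟩
    have := hroom m (by omega)
    exact (hfull m (by omega)).trans (greedyCount_mono _ _ (by omega))
  obtain ⟨j, rfl⟩ := Nat.exists_eq_add_of_le hnk
  -- Starting from `B n` the count rises with slope one up to `B (n + 1)` and then stays at least
  -- that. Both branches lie above the line `t * k + a` on this stretch, because `t < 1`.
  have hmain : min (B (n + 1)) (B n + j) ≤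
      greedyCount factorialGapCompl B (n.factorial + j) := by
    rcases le_total j (B (n + 1)) with h | h
    · have := hfree n (by omega) j h
      omega
    · have h1 := hfull n (by omega)
      have h2 := greedyCount_mono factorialGapCompl B
        (show n.factorial + B (n + 1) ≤ n.factorial + j by omega)
      omega
  have hmain' : min (B (n + 1) : ℝ) (B n + j) ≤
      greedyCount factorialGapCompl B (n.factorial + j) := by exact_mod_cast hmain
  refine le_trans (le_min ?_ ?_) hmain'
  · refine le_trans ?_ (hBlow (n + 1))
    have : ((n.factorial + j : ℕ) : ℝ) ≤ (n + 1).factorial := by exact_mod_cast hkn.le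
    gcongr
  · have := hBlow n
    push_cast
    have hj : (0 : ℝ) ≤ j := by positivity
    nlinarith

/-! ### Dyadic covers and random digits. -/

open Classical in
theorem exists_finset_binaryPrefix (S : Set ℕ) (n : ℕ) :
    ∃ F : Finset ℕ, F.card ≤ 2 ^ Nat.count (· ∈ S) n ∧
      ∀ ω : ℕ → Fin 2, (∀ i ∉ S, ω i = 0) → binaryPrefix ω n ∈ F := by
  induction n with
  | zero => exact ⟨{0}, by simp, fun ω _ => by simp [binaryPrefix]⟩
  | succ n ih =>
    obtain ⟨F, hF, hm⟩ := ih
    by_cases hn : n ∈ S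
    · refine ⟨F.image (2 * ·) ∪ F.image (2 * · + 1), ?_, fun ω hω => ?_⟩
      · refine (Finset.card_union_le _ _).trans ?_
        have h1 := Finset.card_image_le (s := F) (f := (2 * ·))
        have h2 := Finset.card_image_le (s := F) (f := (2 * · + 1))
        rw [Nat.count_succ, if_pos hn, pow_succ]
        omega
      · have h3 := (ω n).isLt
        have h4 := hm ω hω
        simp only [binaryPrefix, Finset.mem_union, Finset.mem_image]
        rcases Nat.lt_or_ge (ω n : ℕ) 1 with h | h
        · exact Or.inl ⟨_, h4, by omega⟩
        · exact Or.inr ⟨_, h4, by omega⟩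
    · refine ⟨F.image (2 * ·), ?_, fun ω hω => ?_⟩
      · rw [Nat.count_succ, if_neg hn]
        exact Finset.card_image_le.trans hF
      · simp only [binaryPrefix, Finset.mem_image]
        exact ⟨_, hm ω hω, by simp [hω n hn]⟩

open Classical in
theorem exists_cover_digitCantor (S : Set ℕ) (n : ℕ) :
    ∃ F : Finset ℕ, F.card ≤ 2 ^ Nat.count (· ∈ S) n ∧ ∀ x ∈ digitCantor S,
      ∃ j ∈ F, x ∈ Set.Icc ((j : ℝ) / 2 ^ n) ((j + 1) / 2 ^ n) := by
  obtain ⟨F, hF, hm⟩ := exists_finset_binaryPrefix S n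
  refine ⟨F, hF, ?_⟩
  rintro _ ⟨ω, hω, rfl⟩
  exact ⟨_, hm ω hω, binaryPrefix_le_ofDigits ω n, ofDigits_le_binaryPrefix ω n⟩

open Classical in
/-- The law of the `i`-th digit: uniform for `i ∈ S`, zero otherwise. -/
noncomputable def digitLaw (S : Set ℕ) (i : ℕ) : Measure (Fin 2) :=
  if i ∈ S then (PMF.uniformOfFintype (Fin 2)).toMeasure else Measure.dirac 0

instance (S : Set ℕ) (i : ℕ) : IsProbabilityMeasure (digitLaw S i) := by
  unfold digitLaw
  split_ifs <;> infer_instance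

open Classical in
theorem digitLaw_singleton_le (S : Set ℕ) (i : ℕ) (x : Fin 2) :
    digitLaw S i {x} ≤ if i ∈ S then 2⁻¹ else 1 := by
  unfold digitLaw
  split_ifs
  · rw [PMF.toMeasure_apply_singleton _ _ (measurableSet_singleton x)]
    simp
  · exact prob_le_one

/-- The law of a sequence of independent digits, uniform at the positions in `S` and zero
elsewhere. -/
noncomputable def digitSeqLaw (S : Set ℕ) : Measure (ℕ → Fin 2) :=
  Measure.infinitePi (digitLaw S)

instance (S : Set ℕ) : IsProbabilityMeasure (digitSeqLaw S) := by
  unfold digitSeqLaw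
  infer_instance

open Classical in
theorem digitSeqLaw_cylinder_le (S : Set ℕ) (n : ℕ) (η : ℕ → Fin 2) :
    digitSeqLaw S {ω | ∀ i < n, ω i = η i} ≤ 2⁻¹ ^ Nat.count (· ∈ S) n := by
  have h : {ω : ℕ → Fin 2 | ∀ i < n, ω i = η i} =
      Set.pi (Finset.range n : Set ℕ) fun i => {η i} := by
    ext ω
    simp
  rw [h, digitSeqLaw, Measure.infinitePi_pi _ fun i _ => measurableSet_singleton _]
  refine (Finset.prod_le_prod' fun i _ => digitLaw_singleton_le S i (η i)).trans ?_
  rw [Finset.prod_ite, Finset.prod_const, Finset.prod_const_one, mul_one,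
    Nat.count_eq_card_filter_range]

open Classical in
theorem digitSeqLaw_binaryPrefix_le (S : Set ℕ) (n j : ℕ) :
    digitSeqLaw S {ω | binaryPrefix ω n = j} ≤ 2⁻¹ ^ Nat.count (· ∈ S) n := by
  by_cases h : ∃ η, binaryPrefix η n = j
  · obtain ⟨η, rfl⟩ := h
    refine (measure_mono ?_).trans (digitSeqLaw_cylinder_le S n η)
    exact fun ω hω => eq_of_binaryPrefix_eq hω
  · have : {ω | binaryPrefix ω n = j} = ∅ := by
      ext ω
      simpa using fun hω => h ⟨ω, hω⟩
    simp [this]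

theorem digitSeqLaw_compl_eq_zero (S : Set ℕ) :
    digitSeqLaw S {ω | ∀ i ∉ S, ω i = 0}ᶜ = 0 := by
  rw [← mem_ae_iff]
  change ∀ᵐ ω ∂digitSeqLaw S, ∀ i ∉ S, ω i = 0
  rw [ae_all_iff]
  intro i
  by_cases hi : i ∈ S
  · simp [hi]
  · have h := measurePreserving_eval_infinitePi (digitLaw S) i
    have h0 : ∀ᵐ x ∂digitLaw S i, x = 0 := by
      rw [digitLaw, if_neg hi]
      simp
    filter_upwards [h.quasiMeasurePreserving.ae h0] with ω hω _ using hω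

/-- The law of the real with random binary digits, independent and uniform at the positions in `S`
and zero elsewhere. -/
noncomputable def digitMeasure (S : Set ℕ) : Measure ℝ := (digitSeqLaw S).map Real.ofDigits

theorem measurable_ofDigits : Measurable (Real.ofDigits : (ℕ → Fin 2) → ℝ) :=
  Real.continuous_ofDigits.measurable

instance (S : Set ℕ) : IsProbabilityMeasure (digitMeasure S) :=
  Measure.isProbabilityMeasure_map measurable_ofDigits.aemeasurable

theorem digitMeasure_digitCantor_compl (S : Set ℕ) : digitMeasure S (digitCantor S)ᶜ = 0 := by
  rw [digitMeasure, Measure.map_apply measurable_ofDigits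
    (isCompact_digitCantor S).measurableSet.compl]
  refine measure_mono_null ?_ (digitSeqLaw_compl_eq_zero S)
  exact fun ω hω h => hω ⟨ω, h, rfl⟩

open Classical in
theorem digitMeasure_Icc_le (S : Set ℕ) (n : ℕ) (x : ℝ) :
    digitMeasure S (Set.Icc (x - 1 / 2 ^ n) (x + 1 / 2 ^ n)) ≤
      4 * 2⁻¹ ^ Nat.count (· ∈ S) n := by
  rw [digitMeasure, Measure.map_apply measurable_ofDigits measurableSet_Icc]
  -- An interval of length two dyadic units meets at most four closed dyadic intervals, those with
  -- index from `q - 2` to `q + 1`.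
  set q := ⌈2 ^ n * x⌉₊
  have hsub : Real.ofDigits ⁻¹' Set.Icc (x - 1 / 2 ^ n) (x + 1 / 2 ^ n) ⊆
      ⋃ j ∈ Finset.Icc (q - 2) (q + 1), {ω | binaryPrefix ω n = j} := by
    rintro ω ⟨h1, h2⟩
    have h3 := binaryPrefix_le_ofDigits ω n
    have h4 := ofDigits_le_binaryPrefix ω n
    have hp : (0 : ℝ) < 2 ^ n := by positivity
    rw [div_le_iff₀ hp] at h3
    rw [le_div_iff₀ hp] at h4
    have e1 : (x - 1 / 2 ^ n) * 2 ^ n = 2 ^ n * x - 1 := by field_simp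
    have e2 : (x + 1 / 2 ^ n) * 2 ^ n = 2 ^ n * x + 1 := by field_simp
    have h5 := mul_le_mul_of_nonneg_right h1 hp.le
    have h6 := mul_le_mul_of_nonneg_right h2 hp.le
    rw [e1] at h5
    rw [e2] at h6
    simp only [Finset.mem_Icc, Set.mem_iUnion, Set.mem_ofPred_eq, exists_prop, exists_eq_right']
    constructor
    · have : q ≤ binaryPrefix ω n + 2 := Nat.ceil_le.2 (by push_cast; linarith)
      omega
    · have := Nat.le_ceil (2 ^ n * x)
      have h7 : (binaryPrefix ω n : ℝ) ≤ (q : ℝ) + 1 := by linarith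
      exact_mod_cast h7
  refine (measure_mono hsub).trans ((measure_biUnion_finset_le _ _).trans ?_)
  refine (Finset.sum_le_sum fun j _ => digitSeqLaw_binaryPrefix_le S n j).trans ?_
  rw [Finset.sum_const, nsmul_eq_mul]
  gcongr
  rw [Nat.card_Icc]
  exact_mod_cast (by omega : q + 1 + 1 - (q - 2) ≤ 4)

/-- The law of a complex number with independent real and imaginary parts of law
`digitMeasure S`. -/
noncomputable def planeDigitMeasure (S : Set ℕ) : Measure ℂ :=
  ((digitMeasure S).prod (digitMeasure S)).map Complex.measurableEquivRealProd.symm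

instance (S : Set ℕ) : IsProbabilityMeasure (planeDigitMeasure S) :=
  Measure.isProbabilityMeasure_map Complex.measurableEquivRealProd.symm.measurable.aemeasurable

open Complex in
theorem planeDigitMeasure_reProdIm (S : Set ℕ) (A B : Set ℝ) :
    planeDigitMeasure S (A ×ℂ B) = digitMeasure S A * digitMeasure S B := by
  rw [planeDigitMeasure, MeasurableEquiv.map_apply, ← Measure.prod_prod]
  rfl

open Complex in
theorem planeDigitMeasure_compl (S : Set ℕ) :
    planeDigitMeasure S (digitCantor S ×ℂ digitCantor S)ᶜ = 0 := by
  have h : (digitCantor S ×ℂ digitCantor S)ᶜ ⊆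
      ((digitCantor S)ᶜ ×ℂ Set.univ) ∪ (Set.univ ×ℂ (digitCantor S)ᶜ) := by
    intro z hz
    simp only [Set.mem_compl_iff, mem_reProdIm, not_and_or, Set.mem_union] at hz ⊢
    simpa using hz
  refine measure_mono_null h (measure_union_null ?_ ?_) <;>
  simp [planeDigitMeasure_reProdIm, digitMeasure_digitCantor_compl]

open Complex Classical in
theorem planeDigitMeasure_closedBall_le (S : Set ℕ) (n : ℕ) (w : ℂ) :
    planeDigitMeasure S (Metric.closedBall w (1 / 2 ^ n)) ≤
      ENNReal.ofReal (16 * (1 / 4) ^ Nat.count (· ∈ S) n) := by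
  have h : Metric.closedBall w (1 / 2 ^ n) ⊆
      Set.Icc (w.re - 1 / 2 ^ n) (w.re + 1 / 2 ^ n) ×ℂ
        Set.Icc (w.im - 1 / 2 ^ n) (w.im + 1 / 2 ^ n) := by
    intro z hz
    rw [mem_closedBall_iff_norm] at hz
    have h1 := abs_le.1 ((Complex.abs_re_le_norm (z - w)).trans hz)
    have h2 := abs_le.1 ((Complex.abs_im_le_norm (z - w)).trans hz)
    rw [Complex.sub_re] at h1
    rw [Complex.sub_im] at h2
    rw [mem_reProdIm]
    exact ⟨⟨by linarith, by linarith⟩, ⟨by linarith, by linarith⟩⟩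
  refine (measure_mono h).trans ?_
  rw [planeDigitMeasure_reProdIm]
  refine (mul_le_mul' (digitMeasure_Icc_le S n _) (digitMeasure_Icc_le S n _)).trans (le_of_eq ?_)
  have e : (2⁻¹ : ENNReal) = ENNReal.ofReal (1 / 2) := by
    rw [one_div, ENNReal.ofReal_inv_of_pos (by norm_num)]
    simp
  have e4 : (4 : ENNReal) = ENNReal.ofReal 4 := by simp
  rw [e, e4, ← ENNReal.ofReal_pow (by norm_num), ← ENNReal.ofReal_mul (by norm_num),
    ← ENNReal.ofReal_mul (by positivity)]
  congr 1
  rw [mul_mul_mul_comm, ← mul_pow]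
  norm_num

/-! ### Positive capacity from summable ball masses. -/

/-- The sum counts the dyadic balls about `w` containing `p`, a discrete stand-in for `log₂ (1 / ‖p
- w‖)`. It is infinite at `p = w`, which the hypothesis excludes; `m` is the first radius index at
which `p` falls outside. -/
theorem exists_nat_le_tsum_indicator {p w : ℂ}
    (h : ∑' k : ℕ, (Metric.closedBall w (1 / 2 ^ k)).indicator (1 : ℂ → ENNReal) p ≠ ⊤) :
    ∃ m : ℕ, (m : ENNReal) ≤
      ∑' k : ℕ, (Metric.closedBall w (1 / 2 ^ k)).indicator (1 : ℂ → ENNReal) p ∧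
      (1 / 2 : ℝ) ^ m ≤ ‖p - w‖ := by
  classical
  have hex : ∃ k : ℕ, p ∉ Metric.closedBall w (1 / 2 ^ k) := by
    by_contra! hcon
    refine h ?_
    simp_rw [fun k => Set.indicator_of_mem (hcon k) (1 : ℂ → ENNReal)]
    simp
  refine ⟨Nat.find hex, ?_, ?_⟩
  · refine le_trans (le_of_eq ?_) (ENNReal.sum_le_tsum (Finset.range (Nat.find hex)))
    have : ∀ k ∈ Finset.range (Nat.find hex),
        (Metric.closedBall w (1 / 2 ^ k)).indicator (1 : ℂ → ENNReal) p = 1 := by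
      intro k hk
      have := Nat.find_min hex (Finset.mem_range.1 hk)
      rw [not_not] at this
      rw [Set.indicator_of_mem this]
      rfl
    rw [Finset.sum_congr rfl this]
    simp
  · have := Nat.find_spec hex
    rw [mem_closedBall_iff_norm, not_le] at this
    rw [one_div_pow]
    exact this.le

/-- A probability measure on `E` whose dyadic balls have uniformly summable mass bounds the
capacity of `E` from below. -/
theorem tendsto_nthDiam_of_measure {E : Set ℂ} (hE : IsCompact E) (μ : Measure ℂ)
    [IsProbabilityMeasure μ] (hμ : μ Eᶜ = 0) {B : ℕ}
    (hB : ∀ w, ∑' k : ℕ, μ (Metric.closedBall w (1 / 2 ^ k)) ≤ B) :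
    Tendsto (nthDiam E) atTop (𝓝 (logCap E)) ∧ 0 < logCap E := by
  have hne : E.Nonempty := by
    rw [Set.nonempty_iff_ne_empty]
    rintro rfl
    simp at hμ
  refine tendsto_nthDiam_of_le hE hne (c := (1 / 2) ^ B) (by positivity)
    (le_nthDiam_of_greedy hE (by positivity) fun n z => ?_)
  set h : ℂ → ℂ → ENNReal := fun w p =>
    ∑' k : ℕ, (Metric.closedBall w (1 / 2 ^ k)).indicator (1 : ℂ → ENNReal) p with hh
  have hm : ∀ w, Measurable (h w) := fun w => Measurable.tsum fun k =>
    measurable_one.indicator measurableSet_closedBall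
  have hint : ∫⁻ p, ∑ j, h (z j) p ∂μ ≤ n * B := by
    rw [lintegral_finsetSum _ fun j _ => hm _]
    have : ∀ j, ∫⁻ p, h (z j) p ∂μ ≤ B := by
      intro j
      simp only [hh]
      rw [lintegral_tsum fun k => (measurable_one.indicator measurableSet_closedBall).aemeasurable]
      simp_rw [lintegral_indicator_one measurableSet_closedBall]
      exact hB _
    refine (Finset.sum_le_sum fun j _ => this j).trans ?_
    simp
  -- Some point of `E` has total potential at most the mean, which is at most `n * B`.
  obtain ⟨p, hp, hple⟩ := exists_notMem_null_le_lintegral (μ := μ) (f := fun p => ∑ j, h (z j) p)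
    (Finset.measurable_fun_sum _ fun j _ => hm _).aemeasurable hμ
  have hsum := hple.trans hint
  have hfin : ∀ j, h (z j) p ≠ ⊤ := fun j => ne_top_of_le_ne_top
    (ENNReal.mul_ne_top (ENNReal.natCast_ne_top n) (ENNReal.natCast_ne_top B))
    ((Finset.single_le_sum (f := fun j => h (z j) p) (fun _ _ => zero_le) (Finset.mem_univ j)).trans
      hsum)
  choose m hm1 hm2 using fun j => exists_nat_le_tsum_indicator (hfin j)
  refine ⟨p, not_not.1 hp, ?_⟩
  have hmB : ∑ j, m j ≤ n * B := by
    have := (Finset.sum_le_sum fun j (_ : j ∈ Finset.univ) => hm1 j).trans hsum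
    exact_mod_cast this
  calc ((1 / 2 : ℝ) ^ B) ^ n = (1 / 2) ^ (n * B) := by rw [← pow_mul, mul_comm]
    _ ≤ (1 / 2) ^ (∑ j, m j) := pow_le_pow_of_le_one (by norm_num) (by norm_num) hmB
    _ = ∏ j, (1 / 2 : ℝ) ^ m j := (Finset.prod_pow_eq_pow_sum _ _ _).symm
    _ ≤ ∏ j, ‖p - z j‖ := Finset.prod_le_prod (fun _ _ => by positivity) fun j _ => hm2 j

-- From `k₀` on, the ball masses are dominated by the geometric series `16 * (4^(-t))^k`.
open Complex Classical in
theorem exists_tsum_planeDigitMeasure_le {S : Set ℕ} {t : ℝ} (ht : 0 < t) {k₀ : ℕ}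
    (h : ∀ k ≥ k₀, t * k ≤ Nat.count (· ∈ S) k) :
    ∃ B : ℕ, ∀ w, ∑' k : ℕ, planeDigitMeasure S (Metric.closedBall w (1 / 2 ^ k)) ≤ B := by
  have hs : Summable fun k : ℕ => (16 : ℝ) * (1 / 4) ^ Nat.count (· ∈ S) k := by
    refine Summable.mul_left _ (Summable.of_norm_bounded_eventually_nat
      (g := fun k : ℕ => ((1 / 4 : ℝ) ^ t) ^ k)
      (summable_geometric_of_lt_one (by positivity)
        (Real.rpow_lt_one (by norm_num) (by norm_num) ht)) ?_)
    filter_upwards [eventually_ge_atTop k₀] with k hk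
    rw [Real.norm_of_nonneg (by positivity), ← Real.rpow_natCast, ← Real.rpow_natCast,
      ← Real.rpow_mul (by norm_num)]
    exact Real.rpow_le_rpow_of_exponent_ge (by norm_num) (by norm_num) (h k hk)
  obtain ⟨B, hB⟩ := exists_nat_ge (∑' k : ℕ, (16 : ℝ) * (1 / 4) ^ Nat.count (· ∈ S) k)
  refine ⟨B, fun w => ?_⟩
  refine (ENNReal.tsum_le_tsum fun k => planeDigitMeasure_closedBall_le S k w).trans ?_
  rw [← ENNReal.ofReal_tsum_of_nonneg (fun k => by positivity) hs]
  exact (ENNReal.ofReal_le_ofReal hB).trans (by simp)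

/-! ### Two-sided bounds for Hausdorff measure. -/

-- Mass distribution principle. The surplus `a` in the count gains `4^a`; the 64 is the 16 of the
-- ball estimate times 4, the latter from `2^(-n) < 2 * diam U` raised to the power `2 * t ≤ 2`.
open Complex Classical in
theorem le_hausdorffMeasure_reProdIm {S : Set ℕ} {t : ℝ} (ht0 : 0 < t) (ht1 : t < 1) {a k₀ : ℕ}
    (h : ∀ k ≥ k₀, t * k + a ≤ Nat.count (· ∈ S) k) :
    ENNReal.ofReal (4 ^ a / 64) ≤ μH[2 * t] (digitCantor S ×ℂ digitCantor S) := by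
  have hball : ∀ n ≥ k₀, ∀ w : ℂ, ENNReal.ofReal (4 ^ a / 64) *
      planeDigitMeasure S (Metric.closedBall w (1 / 2 ^ n)) ≤
        ENNReal.ofReal (1 / 4 * ((1 / 2 : ℝ) ^ (2 * t)) ^ n) := by
    intro n hn w
    refine (mul_le_mul_right (planeDigitMeasure_closedBall_le S n w) _).trans ?_
    rw [← ENNReal.ofReal_mul (by positivity)]
    refine ENNReal.ofReal_le_ofReal ?_
    have h1 : (1 / 4 : ℝ) ^ Nat.count (· ∈ S) n ≤ (1 / 4) ^ (t * n + a) := by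
      rw [← Real.rpow_natCast]
      exact Real.rpow_le_rpow_of_exponent_ge (by norm_num) (by norm_num) (h n hn)
    have h2 : (1 / 4 : ℝ) ^ (t * n + a) = ((1 / 2 : ℝ) ^ (2 * t)) ^ n * (1 / 4) ^ a := by
      rw [Real.rpow_add (by norm_num), Real.rpow_natCast, ← Real.rpow_natCast (_ ^ (2 * t)),
        ← Real.rpow_mul (by norm_num), show (1 / 4 : ℝ) = (1 / 2) ^ (2 : ℝ) by norm_num,
        ← Real.rpow_mul (by norm_num)]
      ring_nf
    have h3 : (4 : ℝ) ^ a * (1 / 4) ^ a = 1 := by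
      rw [← mul_pow]
      norm_num
    calc (4 : ℝ) ^ a / 64 * (16 * (1 / 4) ^ Nat.count (· ∈ S) n)
        ≤ (4 : ℝ) ^ a / 64 * (16 * (((1 / 2 : ℝ) ^ (2 * t)) ^ n * (1 / 4) ^ a)) := by
          rw [← h2]
          gcongr
      _ = 1 / 4 * ((1 / 2 : ℝ) ^ (2 * t)) ^ n * (4 ^ a * (1 / 4) ^ a) := by ring
      _ = _ := by rw [h3, mul_one]
  have hle : ENNReal.ofReal (4 ^ a / 64) • planeDigitMeasure S ≤ μH[2 * t] := by
    refine Measure.le_hausdorffMeasure _ _ (ENNReal.ofReal ((1 / 2) ^ k₀))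
      (by positivity) fun U hU => ?_
    rw [Measure.smul_apply, smul_eq_mul]
    rcases U.eq_empty_or_nonempty with rfl | ⟨x, hx⟩
    · simp
    have htop : Metric.ediam U ≠ ⊤ := ne_top_of_le_ne_top ENNReal.ofReal_ne_top hU
    have hbdd : Bornology.IsBounded U := Metric.isBounded_iff_ediam_ne_top.2 htop
    have hd : Metric.ediam U = ENNReal.ofReal (Metric.diam U) :=
      (ENNReal.ofReal_toReal htop).symm
    have hd0 : 0 ≤ Metric.diam U := Metric.diam_nonneg
    have hdle : Metric.diam U ≤ (1 / 2) ^ k₀ := by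
      rw [hd] at hU
      exact (ENNReal.ofReal_le_ofReal_iff (by positivity)).1 hU
    have hsub : ∀ n ≥ k₀, Metric.diam U ≤ (1 / 2) ^ n →
        ENNReal.ofReal (4 ^ a / 64) * planeDigitMeasure S U ≤
          ENNReal.ofReal (1 / 4 * ((1 / 2 : ℝ) ^ (2 * t)) ^ n) := by
      intro n hn hdn
      refine (mul_le_mul_right (measure_mono fun y hy => ?_) _).trans (hball n hn x)
      rw [Metric.mem_closedBall, ← one_div_pow]
      exact (Metric.dist_le_diam_of_mem hbdd hy hx).trans hdn
    -- A set of diameter zero lies in balls of every dyadic radius, so its mass vanishes in the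
    -- limit; otherwise `n` is the dyadic scale just above the diameter.
    rcases hd0.eq_or_lt with h0 | hpos
    · have hlim : Tendsto (fun n : ℕ => ENNReal.ofReal (1 / 4 * ((1 / 2 : ℝ) ^ (2 * t)) ^ n)) atTop
          (𝓝 (ENNReal.ofReal (1 / 4 * 0))) := by
        refine ENNReal.tendsto_ofReal (Tendsto.const_mul _ ?_)
        exact tendsto_pow_atTop_nhds_zero_of_lt_one (by positivity)
          (Real.rpow_lt_one (by norm_num) (by norm_num) (by linarith))
      have := ge_of_tendsto hlim ((eventually_ge_atTop k₀).mono fun n hn =>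
        hsub n hn (by rw [← h0]; positivity))
      refine this.trans ?_
      simp
    · obtain ⟨n, hn1, hn2⟩ := exists_nat_pow_near_of_lt_one hpos
        (hdle.trans (pow_le_one₀ (by norm_num) (by norm_num))) (by norm_num : (0 : ℝ) < 1 / 2)
        (by norm_num)
      have hn : k₀ ≤ n := by
        have := (pow_lt_pow_iff_right_of_lt_one₀ (by norm_num : (0 : ℝ) < 1 / 2)
          (by norm_num)).1 (hn1.trans_le hdle)
        omega
      refine (hsub n hn hn2).trans ?_
      rw [hd, ENNReal.ofReal_rpow_of_pos hpos]
      refine ENNReal.ofReal_le_ofReal ?_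
      have e1 : ((1 / 2 : ℝ) ^ (2 * t)) ^ n = ((1 / 2 : ℝ) ^ n) ^ (2 * t) := by
        rw [← Real.rpow_natCast, ← Real.rpow_mul (by norm_num), mul_comm,
          Real.rpow_mul (by norm_num), Real.rpow_natCast]
      have e2 : ((1 / 2 : ℝ) ^ n) ^ (2 * t) ≤ (2 * Metric.diam U) ^ (2 * t) := by
        refine Real.rpow_le_rpow (by positivity) ?_ (by linarith)
        rw [pow_succ] at hn1
        linarith
      rw [Real.mul_rpow (by norm_num) hd0] at e2
      have e3 : (2 : ℝ) ^ (2 * t) ≤ 4 := by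
        refine (Real.rpow_le_rpow_of_exponent_le (by norm_num)
          (by linarith : 2 * t ≤ 2)).trans ?_
        norm_num
      rw [e1]
      have := mul_le_mul_of_nonneg_right e3 (Real.rpow_nonneg hd0 (2 * t))
      linarith
  have huniv : planeDigitMeasure S (digitCantor S ×ℂ digitCantor S) = 1 :=
    (prob_compl_eq_zero_iff (((isCompact_digitCantor S).reProdIm
      (isCompact_digitCantor S)).measurableSet)).1 (planeDigitMeasure_compl S)
  have := hle (digitCantor S ×ℂ digitCantor S)
  rwa [Measure.smul_apply, huniv, smul_eq_mul, mul_one] at this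

theorem hausdorffMeasure_le_of_covers {X β : Type*} [EMetricSpace X] [MeasurableSpace X]
    [BorelSpace X] {d : ℝ} (hd : 0 ≤ d) {A : Set X} (F : ℕ → Finset β) (u : ℕ → β → Set X)
    {δ : ℕ → ℝ} (hδ : Tendsto δ atTop (𝓝 0)) (hδ0 : ∀ n, 0 ≤ δ n)
    (hdiam : ∀ n j, Metric.ediam (u n j) ≤ ENNReal.ofReal (δ n))
    (hcov : ∀ n, ∀ x ∈ A, ∃ j ∈ F n, x ∈ u n j) {B : ℝ}
    (hB : ∀ n, (F n).card * δ n ^ d ≤ B) : μH[d] A ≤ ENNReal.ofReal B := by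
  have hr : Tendsto (fun n => ENNReal.ofReal (δ n)) atTop (𝓝 0) := by
    simpa using ENNReal.tendsto_ofReal hδ
  refine (Measure.hausdorffMeasure_le_liminf_sum (ι := fun n => F n) d A _ hr
    (fun n j => u n j) (Eventually.of_forall fun n j => hdiam n j)
    (Eventually.of_forall fun n x hx => ?_)).trans ?_
  · obtain ⟨j, hj, hxj⟩ := hcov n x hx
    exact Set.mem_iUnion.2 ⟨⟨j, hj⟩, hxj⟩
  · have h : ∀ n, ∑ j : F n, Metric.ediam (u n j) ^ d ≤ ENNReal.ofReal B := by
      intro n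
      have h1 : ∑ j : F n, Metric.ediam (u n j) ^ d ≤ ∑ _j : F n, ENNReal.ofReal (δ n) ^ d :=
        Finset.sum_le_sum fun j _ => ENNReal.rpow_le_rpow (hdiam n j) hd
      refine h1.trans ?_
      rw [Finset.sum_const, nsmul_eq_mul, ENNReal.ofReal_rpow_of_nonneg (hδ0 n) hd,
        Finset.card_univ, Fintype.card_coe, ← ENNReal.ofReal_natCast,
        ← ENNReal.ofReal_mul (by positivity)]
      exact ENNReal.ofReal_le_ofReal (hB n)
    refine (liminf_le_liminf (Eventually.of_forall h)).trans ?_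
    simp

theorem tendsto_one_half_pow_factorial :
    Tendsto (fun n : ℕ => (1 / 2 : ℝ) ^ n.factorial) atTop (𝓝 0) :=
  (tendsto_pow_atTop_nhds_zero_of_lt_one (by norm_num) (by norm_num)).comp
    (tendsto_atTop_mono Nat.self_le_factorial tendsto_id)

theorem card_mul_rpow_le {t : ℝ} {a N c m : ℕ} (hc : (c : ℝ) ≤ t * N + a + 1)
    (hm : m ≤ 2 ^ c) : (m : ℝ) * ((1 / 2 : ℝ) ^ N) ^ t ≤ 2 ^ (a + 1) := by
  have h1 : (m : ℝ) ≤ 2 ^ (t * N + a + 1) := by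
    refine le_trans (by exact_mod_cast hm : (m : ℝ) ≤ 2 ^ c) ?_
    rw [← Real.rpow_natCast]
    exact Real.rpow_le_rpow_of_exponent_le (by norm_num) hc
  have h2 : ((1 / 2 : ℝ) ^ N) ^ t = 2 ^ (-(t * N)) := by
    rw [one_div, ← Real.rpow_natCast, ← Real.rpow_mul (by norm_num), Real.inv_rpow (by norm_num),
      Real.rpow_neg (by norm_num), mul_comm]
  rw [h2]
  refine (mul_le_mul_of_nonneg_right h1 (by positivity)).trans (le_of_eq ?_)
  rw [← Real.rpow_add (by norm_num), ← Real.rpow_natCast]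
  congr 1
  push_cast
  ring

open Classical in
theorem hausdorffMeasure_digitCantor_le {S : Set ℕ} {t : ℝ} (ht0 : 0 < t) {a : ℕ}
    (h : ∀ n : ℕ, (Nat.count (· ∈ S) n.factorial : ℝ) ≤ t * n.factorial + a + 1) :
    μH[t] (digitCantor S) ≤ ENNReal.ofReal (2 ^ (a + 1)) := by
  choose F hF hm using exists_cover_digitCantor S
  refine hausdorffMeasure_le_of_covers ht0.le (fun n => F n.factorial)
    (fun n j => Set.Icc ((j : ℝ) / 2 ^ n.factorial) ((j + 1) / 2 ^ n.factorial))
    tendsto_one_half_pow_factorial (fun n => by positivity) (fun n j => ?_)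
    (fun n x hx => hm _ x hx) (fun n => card_mul_rpow_le (h n) (hF _))
  rw [Real.ediam_Icc, add_div, add_sub_cancel_left, one_div_pow]

open Complex in
theorem ediam_reProdIm_Icc_le (x y δ : ℝ) :
    Metric.ediam (Set.Icc x (x + δ) ×ℂ Set.Icc y (y + δ)) ≤ ENNReal.ofReal (2 * δ) := by
  refine Metric.ediam_le fun z hz w hw => ?_
  rw [mem_reProdIm] at hz hw
  rw [edist_dist]
  refine ENNReal.ofReal_le_ofReal ?_
  rw [dist_eq_norm]
  refine (Complex.norm_le_abs_re_add_abs_im _).trans ?_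
  rw [Complex.sub_re, Complex.sub_im]
  have h1 := abs_sub_le_of_le_of_le hz.1.1 hz.1.2 hw.1.1 hw.1.2
  have h2 := abs_sub_le_of_le_of_le hz.2.1 hz.2.2 hw.2.1 hw.2.2
  linarith

-- Hausdorff measure is controlled by covers along any sequence of scales tending to zero, so the
-- scales `2^(-n!)`, the only ones at which the count is bounded above, suffice.
open Complex Classical in
theorem hausdorffMeasure_reProdIm_ne_top {S : Set ℕ} {t : ℝ} (ht0 : 0 < t) {a : ℕ}
    (h : ∀ n : ℕ, (Nat.count (· ∈ S) n.factorial : ℝ) ≤ t * n.factorial + a + 1) :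
    μH[2 * t] (digitCantor S ×ℂ digitCantor S) ≠ ⊤ := by
  choose F hF hm using exists_cover_digitCantor S
  refine ne_top_of_le_ne_top ENNReal.ofReal_ne_top (hausdorffMeasure_le_of_covers
    (B := 2 ^ (t * 2) * (2 ^ (a + 1)) ^ 2)
    (by positivity) (fun n => F n.factorial ×ˢ F n.factorial)
    (fun n j => Set.Icc ((j.1 : ℝ) / 2 ^ n.factorial) ((j.1 : ℝ) / 2 ^ n.factorial +
      (1 / 2) ^ n.factorial) ×ℂ Set.Icc ((j.2 : ℝ) / 2 ^ n.factorial)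
      ((j.2 : ℝ) / 2 ^ n.factorial + (1 / 2) ^ n.factorial))
    (δ := fun n => 2 * (1 / 2) ^ n.factorial)
    (by simpa using tendsto_one_half_pow_factorial.const_mul 2) (fun n => by positivity)
    (fun n j => ediam_reProdIm_Icc_le _ _ _) (fun n z hz => ?_) (fun n => ?_))
  · rw [mem_reProdIm] at hz
    obtain ⟨j, hj, hzj⟩ := hm n.factorial _ hz.1
    obtain ⟨k, hk, hzk⟩ := hm n.factorial _ hz.2
    rw [add_div, ← one_div_pow] at hzj hzk
    exact ⟨(j, k), Finset.mk_mem_product hj hk, hzj, hzk⟩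
  · have h1 := card_mul_rpow_le (h n) (hF n.factorial)
    rw [Finset.card_product, Real.mul_rpow (by norm_num) (by positivity), mul_comm 2 t,
      Real.rpow_mul (by positivity : (0 : ℝ) ≤ (1 / 2) ^ n.factorial) t 2, Real.rpow_two]
    push_cast
    calc _ = (2 : ℝ) ^ (t * 2) * ((F n.factorial).card *
          ((1 / 2 : ℝ) ^ n.factorial) ^ t) ^ 2 := by ring
      _ ≤ _ := by gcongr

-- A vertical slice embeds isometrically in `digitCantor S`, which has finite measure in dimension
-- `t < 2 * t`.
open Complex Classical in
theorem hausdorffMeasure_vertical_eq_zero {S : Set ℕ} {t : ℝ} (ht0 : 0 < t) {a : ℕ}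
    (h : ∀ n : ℕ, (Nat.count (· ∈ S) n.factorial : ℝ) ≤ t * n.factorial + a + 1) (x : ℝ) :
    μH[2 * t] ((digitCantor S ×ℂ digitCantor S) ∩ {z | z.re = x}) = 0 := by
  have hiso : Isometry fun y : ℝ => (x : ℂ) + y * I := by
    refine Isometry.of_dist_eq fun y z => ?_
    rw [dist_add_left, dist_eq_norm, ← sub_mul, norm_mul, Complex.norm_I, mul_one,
      ← Complex.ofReal_sub, Complex.norm_real, Real.dist_eq, Real.norm_eq_abs]
  have hsub : (digitCantor S ×ℂ digitCantor S) ∩ {z | z.re = x} ⊆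
      (fun y : ℝ => (x : ℂ) + y * I) '' digitCantor S := by
    rintro z ⟨hz, rfl⟩
    exact ⟨z.im, hz.2, Complex.re_add_im z⟩
  refine measure_mono_null hsub ?_
  rw [hiso.hausdorffMeasure_image (Or.inl (by positivity))]
  refine (Measure.hausdorffMeasure_zero_or_top (by linarith : t < 2 * t) _).resolve_right ?_
  exact ne_top_of_le_ne_top ENNReal.ofReal_ne_top (hausdorffMeasure_digitCantor_le ht0 h)

/-- A set of finite measure whose vertical slices are null can be cut by a vertical line to any
smaller measure. -/
theorem exists_measure_inter_re_le_eq (μ : Measure ℂ) {K : Set ℂ} (hfin : μ K ≠ ⊤)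
    (hre : ∀ z ∈ K, z.re ∈ Set.Icc (0 : ℝ) 1) (hnull : ∀ x : ℝ, μ (K ∩ {z | z.re = x}) = 0) {c : ℝ} (hc0 : 0 ≤ c)
    (hc : ENNReal.ofReal c ≤ μ K) :
    ∃ x : ℝ, μ (K ∩ {z | z.re ≤ x}) = ENNReal.ofReal c := by
  have hm : Measurable Complex.re := Complex.measurable_re
  have : IsFiniteMeasure (μ.restrict K) := isFiniteMeasure_restrict.2 hfin
  set ρ : Measure ℝ := (μ.restrict K).map Complex.re with hρ
  have happ : ∀ x, ρ (Set.Ioc (-1) x) = μ (K ∩ {z | z.re ≤ x}) := by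
    intro x
    rw [hρ, Measure.map_apply hm measurableSet_Ioc, Measure.restrict_apply (hm measurableSet_Ioc)]
    congr 1
    ext z
    constructor
    · exact fun hz => ⟨hz.2, hz.1.2⟩
    · exact fun hz => ⟨⟨by linarith [(hre z hz.1).1], hz.2⟩, hz.1⟩
  have : NullSingletonClass ρ := ⟨fun x => by
    rw [hρ, Measure.map_apply hm (measurableSet_singleton x),
      Measure.restrict_apply (hm (measurableSet_singleton x)), Set.inter_comm]
    exact hnull x⟩
  -- Null slices mean that `ρ` has no atoms, so its distribution function is continuous and the
  -- intermediate value theorem applies. Starting at `-1` captures all of `K`, including real part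
  -- `0`.
  have hcont : Continuous fun b => ∫ _ in (-1 : ℝ)..b, (1 : ℝ) ∂ρ :=
    intervalIntegral.continuous_primitive (fun a b => intervalIntegrable_const) (-1)
  have hval : ∀ b, -1 ≤ b → ∫ _ in (-1 : ℝ)..b, (1 : ℝ) ∂ρ = ρ.real (Set.Ioc (-1) b) := by
    intro b hb
    rw [intervalIntegral.integral_of_le hb]
    simp
  have htot : μ (K ∩ {z | z.re ≤ 1}) = μ K := by
    congr 1
    exact Set.inter_eq_left.2 fun z hz => (hre z hz).2
  obtain ⟨x, hx, hxc⟩ := intermediate_value_Icc (by norm_num : (-1 : ℝ) ≤ 1) hcont.continuousOn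
    (show c ∈ Set.Icc _ _ from ⟨by simpa using hc0, by
      rw [hval 1 (by norm_num), Measure.real, happ, htot]
      exact (ENNReal.ofReal_le_iff_le_toReal hfin).1 hc⟩)
  refine ⟨x, ?_⟩
  simp only at hxc
  rw [hval x hx.1] at hxc
  rw [← happ, ← hxc, ofReal_measureReal]

/-! ### The factorial-gap square and the final assembly. -/

open Complex in
theorem isCompact_factorialGapSquare :
    IsCompact (digitCantor factorialGapCompl ×ℂ digitCantor factorialGapCompl) :=
  (isCompact_digitCantor _).reProdIm (isCompact_digitCantor _)

open Complex in
theorem exists_compact_subset_hausdorffMeasure_eq {s c : ℝ} (hs0 : 0 < s) (hs2 : s < 2)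
    (hc : 0 < c) :
    ∃ K ⊆ digitCantor factorialGapCompl ×ℂ digitCantor factorialGapCompl, IsCompact K ∧
      dimH K = ENNReal.ofReal s ∧ μH[s] K = ENNReal.ofReal c := by
  -- The choice `4^a > 64 * c` lifts the lower bound `4^a / 64` above `c`, leaving room to cut down
  -- to exactly `c`.
  obtain ⟨a, ha⟩ := pow_unbounded_of_one_lt (64 * c) (by norm_num : (1 : ℝ) < 4)
  obtain ⟨T, hT, ⟨k₀, hk₀⟩, hup⟩ := exists_subset_count (t := s / 2) (by linarith) (by linarith) a
  have e : 2 * (s / 2) = s := by ring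
  have hlow := le_hausdorffMeasure_reProdIm (by linarith) (by linarith) hk₀
  have hfin := hausdorffMeasure_reProdIm_ne_top (by linarith) hup
  have hnull := hausdorffMeasure_vertical_eq_zero (by linarith) hup
  rw [e] at hlow hfin hnull
  have hcomp : IsCompact (digitCantor T ×ℂ digitCantor T) :=
    (isCompact_digitCantor T).reProdIm (isCompact_digitCantor T)
  obtain ⟨x, hx⟩ := exists_measure_inter_re_le_eq μH[s] hfin
    (fun z hz => digitCantor_subset_Icc T hz.1) hnull hc.le
    ((ENNReal.ofReal_le_ofReal (by linarith)).trans hlow)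
  refine ⟨_, ?_, hcomp.inter_right (isClosed_le Complex.continuous_re continuous_const), ?_, hx⟩
  · exact fun z hz => ⟨digitCantor_mono hT hz.1.1, digitCantor_mono hT hz.1.2⟩
  · rw [ENNReal.ofReal]
    refine dimH_of_hausdorffMeasure_ne_zero_ne_top ?_ ?_ <;>
    rw [Real.coe_toNNReal s hs0.le, hx]
    · simpa using hc
    · exact ENNReal.ofReal_ne_top

open Complex in
theorem dimH_factorialGapSquare :
    dimH (digitCantor factorialGapCompl ×ℂ digitCantor factorialGapCompl) = 2 := by
  refine le_antisymm ?_ (le_of_forall_lt fun d hd => ?_)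
  · refine (dimH_mono (Set.subset_univ _)).trans ?_
    rw [Real.dimH_univ_eq_finrank, Complex.finrank_real_complex]
    simp
  · lift d to NNReal using hd.ne_top
    have hd2 : (d : ℝ) < 2 := by exact_mod_cast hd
    obtain ⟨K, hK, -, hdim, -⟩ := exists_compact_subset_hausdorffMeasure_eq (s := (d + 2) / 2)
      (c := 1) (by positivity) (by linarith) one_pos
    refine lt_of_lt_of_le ?_ (dimH_mono hK)
    rw [hdim, ← ENNReal.ofReal_coe_nnreal, ENNReal.ofReal_lt_ofReal_iff (by positivity)]
    linarith

open Complex in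
theorem logCap_factorialGapSquare_pos :
    Tendsto (nthDiam (digitCantor factorialGapCompl ×ℂ digitCantor factorialGapCompl)) atTop
      (𝓝 (logCap (digitCantor factorialGapCompl ×ℂ digitCantor factorialGapCompl))) ∧
    0 < logCap (digitCantor factorialGapCompl ×ℂ digitCantor factorialGapCompl) := by
  -- Any positive density makes the ball masses summable; `1 / 2` is an arbitrary choice.
  obtain ⟨T, hT, ⟨k₀, hk₀⟩, -⟩ :=
    exists_subset_count (t := 1 / 2) (by norm_num) (by norm_num) 0
  obtain ⟨B, hB⟩ := exists_tsum_planeDigitMeasure_le (S := T) (t := 1 / 2) (by norm_num)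
    (k₀ := k₀) fun k hk => by simpa using hk₀ k hk
  refine tendsto_nthDiam_of_measure isCompact_factorialGapSquare (planeDigitMeasure T) ?_ hB
  refine measure_mono_null (Set.compl_subset_compl.2 fun z hz => ?_) (planeDigitMeasure_compl T)
  exact ⟨digitCantor_mono hT hz.1, digitCantor_mono hT hz.2⟩

open Complex in
theorem nontrivial_factorialGapSquare :
    (digitCantor factorialGapCompl ×ℂ digitCantor factorialGapCompl).Nontrivial := by
  by_contra h
  have := dimH_subsingleton (Set.not_nontrivial_iff.1 h)
  rw [dimH_factorialGapSquare] at this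
  norm_num at this

/-- Convergence accompanies positivity of `logCap E` because `limUnder` has a meaningful value only
when the limit exists. -/
theorem theorem3 :
    ∃ E : Set ℂ,
      IsHNUP E ∧ dimH E = 2 ∧ volume E = 0 ∧
      (Tendsto (nthDiam E) atTop (𝓝 (logCap E)) ∧ 0 < logCap E) ∧
      (∀ s c : ℝ, 0 < s → s < 2 → 0 < c →
        ∃ K : Set ℂ, K ⊆ E ∧ IsHNUP K ∧
          dimH K = ENNReal.ofReal s ∧ μH[s] K = ENNReal.ofReal c) ∧
      (∀ x ∈ E, ∀ M : ℝ, 1 < M →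
        ∃ r R : ℝ, 0 < r ∧ 0 < R ∧ M ≤ R / r ∧
          {y : ℂ | r < ‖y - x‖ ∧ ‖y - x‖ < R} ⊆ Eᶜ ∧
          ({y : ℂ | R ≤ ‖y - x‖} ∩ E).Nonempty) := by
  have hA := hasThickSmallAnnuli_reProdIm exists_long_gap
  have hE := hA.isHNUP isCompact_factorialGapSquare
  refine ⟨_, hE, dimH_factorialGapSquare, hA.volume_eq_zero isCompact_factorialGapSquare,
    logCap_factorialGapSquare_pos, fun s c hs0 hs2 hc => ?_,
    hA.exists_annulus nontrivial_factorialGapSquare⟩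
  obtain ⟨K, hK, hKc, hdim, hmeas⟩ := exists_compact_subset_hausdorffMeasure_eq hs0 hs2 hc
  exact ⟨K, hK, hE.subset hKc hK, hdim, hmeas⟩
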